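/- Let $N$ be a finite non-empty set of players, $n_\nu\in\mathbb{N}$ for $\nu\in N$, and let $\mathbb{R}^n=\prod_{\nu\in N}\mathbb{R}^{n_\nu}$ carry the Euclidean norm $\|\cdot\|$. For each player $\nu\in N$ let $K_\nu\subseteq\mathbb{R}^{n_\nu}$, put $K=\prod_{\nu\in N}K_\nu$, and let $X_\nu:K\rightrightarrows\mathbb{R}^{n_\nu}$ be a set-valued map (its values need not be contained in $K_\nu$) and $\theta_\nu:\mathbb{R}^n\to\mathbb{R}$ a function. For $x\in\mathbb{R}^n$ and $z^\nu\in\mathbb{R}^{n_\nu}$ write $(z^\nu,x^{-\nu})$ for the vector $x$ with its $\nu$-th block replaced by $z^\nu$. A set-valued map is continuous if it is both upper semicontinuous (for every $x$ and every open $V\supseteq T(x)$, one has $T(x')\subseteq V$ for all $x'$ near $x$) and lower semicontinuous (for every $x$ and every open $V$ with $T(x)\cap V\neq\emptyset$, one has $T(x')\cap V\neq\emptyset$ for all $x'$ near $x$). A function $f:\mathbb{R}^n\to\mathbb{R}$ is upper pseudo-continuous if whenever $f(x)<f(y)$ there is a neighbourhood $V$ of $x$ with $f(x')<f(y)$ for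 all $x'\in V$; it is pseudo-continuous if both $f$ and $-f$ are upper pseudo-continuous. Assume that for each $\nu\in N$: 1. $K_\nu$ is convex, closed and non-empty; 2. $X_\nu$ is continuous with convex, compact and non-empty values; 3. $X_\nu(K)=\bigcup_{x\in K}X_\nu(x)$ is bounded; 4. $\theta_\nu$ is pseudo-continuous; 5. for every $x^{-\nu}\in\prod_{\mu\in N\setminus\{\nu\}}\mathbb{R}^{n_\mu}$, the function $z^\nu\mapsto\theta_\nu(z^\nu,x^{-\nu})$ is quasi-convex on $\mathbb{R}^{n_\nu}$. Then there exists a projected solution, that is, there are $\hat{x}\in K$ and $\hat{y}\in\prod_{\nu\in N}X_\nu(\hat{x})$ such that - $\hat{x}$ is a projection of $\hat{y}$ onto $K$, i.e. $\|\hat{y}-\hat{x}\|\le\|\hat{y}-x\|$ for all $x\in K$; and - $\hat{y}$ is a Nash equilibrium of the game with losses $\theta_\nu$ and strategy sets $X_\nu(\hat{x})$, i.e. $\theta_\nu(\hat{y})\le\theta_\nu(z^\nu,\hat{y}^{-\nu})$ for every $\nu\in N$ and every $z^\nu\in X_\nu(\hat{x})$. -/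

import Mathlib

/-- The joint strategy space `ℝⁿ = ∏ ν, ℝ^(n ν)`, with the Euclidean (`ℓ²`) norm. -/
abbrev JointSpace {N : Type*} (n : N → ℕ) : Type _ :=
  PiLp 2 (fun ν => EuclideanSpace ℝ (Fin (n ν)))

/-- The joint strategy set `K = ∏ ν, K ν`. -/
def jointSet {N : Type*} {n : N → ℕ} (K : ∀ ν, Set (EuclideanSpace ℝ (Fin (n ν)))) :
    Set (JointSpace n) :=
  {x | ∀ ν, x ν ∈ K ν}

/-- The strategy profile `(z, x^{-ν})`: player `ν` plays `z`, the others play as in `x`. -/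
def deviate {N : Type*} [DecidableEq N] {n : N → ℕ} (x : JointSpace n) (ν : N)
    (z : EuclideanSpace ℝ (Fin (n ν))) : JointSpace n :=
  WithLp.toLp 2 (Function.update (WithLp.ofLp x) ν z)

/-- The (set-valued) projection of `z` onto `A`: the nearest points of `A` to `z`. -/
def metricProj {E : Type*} [NormedAddCommGroup E] (A : Set E) (z : E) : Set E :=
  {w | w ∈ A ∧ ∀ x ∈ A, ‖z - w‖ ≤ ‖z - x‖}

/-- A set-valued map is continuous if it is both upper and lower semicontinuous
(called hemicontinuous in Mathlib). -/
def SetValuedContinuous {X Y : Type*} [TopologicalSpace X] [TopologicalSpace Y]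
    (T : X → Set Y) : Prop :=
  UpperHemicontinuous T ∧ LowerHemicontinuous T

/-- Upper pseudo-continuity: whenever `f x < f y`, also `f x' < f y` for all `x'` near `x`. -/
def UpperPseudoContinuous {X : Type*} [TopologicalSpace X] (f : X → ℝ) : Prop :=
  ∀ x y, f x < f y → ∃ V ∈ nhds x, ∀ x' ∈ V, f x' < f y

/-- Lower pseudo-continuity: `-f` is upper pseudo-continuous. -/
def LowerPseudoContinuous {X : Type*} [TopologicalSpace X] (f : X → ℝ) : Prop :=
  UpperPseudoContinuous (fun x => -f x)

/-- Pseudo-continuity: lower and upper pseudo-continuity. -/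
def PseudoContinuous {X : Type*} [TopologicalSpace X] (f : X → ℝ) : Prop :=
  LowerPseudoContinuous f ∧ UpperPseudoContinuous f

/-- The set of Nash equilibria of the game in which player `ν` minimizes the loss `θ ν` in its
own variable over the strategy set `Y ν`. -/
def nashEquilibria {N : Type*} [DecidableEq N] {n : N → ℕ} (θ : N → JointSpace n → ℝ)
    (Y : ∀ ν, Set (EuclideanSpace ℝ (Fin (n ν)))) : Set (JointSpace n) :=
  {y | y ∈ jointSet Y ∧ ∀ ν, ∀ z ∈ Y ν, θ ν y ≤ θ ν (deviate y ν z)}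

/-- `x ∈ K` is a projected solution of the generalized Nash game with losses `θ ν` and constraint
maps `X ν : K ⇉ ℝ^(n ν)` (whose values need not lie in `K ν`) if `x` is a projection onto `K` of
some `y ∈ ∏ ν, X ν x` that is a Nash equilibrium of the game with strategy sets `X ν x`. -/
def IsProjectedSolution {N : Type*} [Fintype N] [DecidableEq N] {n : N → ℕ}
    (K : ∀ ν, Set (EuclideanSpace ℝ (Fin (n ν))))
    (X : ∀ ν, jointSet K → Set (EuclideanSpace ℝ (Fin (n ν))))
    (θ : N → JointSpace n → ℝ) (x : jointSet K) : Prop :=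
  ∃ y ∈ jointSet (fun ν => X ν x),
    (x : JointSpace n) ∈ metricProj (jointSet K) y ∧ y ∈ nashEquilibria θ (fun ν => X ν x)

/-! The fixed point is sought for `y`, which ranges over all of ℝⁿ, rather than for `x` in `K`. With
`P` the projection onto `K`, let `B(y)` be the product over the players of the minimisers of `θ ν`
against `y` over `X ν (P y)`. If `y ∈ B(y)`, then `y` is a Nash equilibrium for the sets `X ν (P
y)`, and `P y` is a projected solution.

Kakutani's theorem gives such a `y`: the values of `B` are non-empty by compactness, convex by
quasi-convexity and uniformly bounded. The delicate point is the closed graph of `B`, as `θ ν` need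
not be continuous. By connectedness of ℝⁿ, pseudo-continuity makes the strict preference `θ ν u < θ
ν v` open in `(u, v)` (`PseudoContinuous.isOpen_lt`); lower hemicontinuity of `X ν` then carries a
better reply over to nearby data.

Kakutani is reduced to Brouwer by smooth approximate selections and separation by half spaces.
Brouwer rests on the absence of a regular retraction `r` onto the sphere: the integral of `det (1 +
t (Dr - 1))` over the ball is polynomial in `t` and equals the ball's volume for small `t > 0`, yet
vanishes at `t = 1`. -/

open Metric MeasureTheory

open scoped NNReal Topology ContDiff Manifold

/-! ### No retraction of the ball onto the sphere, by a volume argument -/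

/-- The radial retraction onto the closed unit ball is Lipschitz. -/
lemma lipschitzWith_radial_retraction {E : Type*} [NormedAddCommGroup E] [NormedSpace ℝ E] :
    LipschitzWith 2 (fun x : E => (max 1 ‖x‖)⁻¹ • x) := by
  refine LipschitzWith.of_dist_le_mul fun x y => ?_
  simp only [dist_eq_norm, NNReal.coe_ofNat]
  have key : ∀ x y : E, (max 1 ‖x‖)⁻¹ • x - (max 1 ‖y‖)⁻¹ • y
      = (max 1 ‖x‖)⁻¹ • (x - y) + ((max 1 ‖x‖)⁻¹ - (max 1 ‖y‖)⁻¹) • y := by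
    intro x y; module
  rw [key]
  set a := max 1 ‖x‖
  set b := max 1 ‖y‖
  have ha : 1 ≤ a := le_max_left _ _
  have hb : 1 ≤ b := le_max_left _ _
  have hyb : ‖y‖ ≤ b := le_max_right _ _
  have hab : |b - a| ≤ ‖x - y‖ := by
    have h1 : |b - a| ≤ |‖y‖ - ‖x‖| := by
      simpa using abs_max_sub_max_le_max 1 ‖y‖ 1 ‖x‖
    exact h1.trans (by rw [norm_sub_rev]; exact abs_norm_sub_norm_le y x)
  have h1 : ‖a⁻¹ • (x - y)‖ ≤ ‖x - y‖ := by
    rw [norm_smul, Real.norm_of_nonneg (by positivity)]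
    exact mul_le_of_le_one_left (norm_nonneg _) (inv_le_one_of_one_le₀ ha)
  have h2 : ‖(a⁻¹ - b⁻¹) • y‖ ≤ ‖x - y‖ := by
    have : a⁻¹ - b⁻¹ = (b - a) * a⁻¹ * b⁻¹ := by field_simp
    rw [norm_smul, this, norm_mul, norm_mul, Real.norm_eq_abs, norm_inv, norm_inv,
      Real.norm_of_nonneg (by positivity), Real.norm_of_nonneg (by positivity)]
    have h3 : b⁻¹ * ‖y‖ ≤ 1 := by
      rw [inv_mul_le_iff₀ (by positivity)]; simpa using hyb
    have h4 : a⁻¹ ≤ 1 := inv_le_one_of_one_le₀ ha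
    calc |b - a| * a⁻¹ * b⁻¹ * ‖y‖ = |b - a| * (a⁻¹ * (b⁻¹ * ‖y‖)) := by ring
      _ ≤ |b - a| * 1 := by
        gcongr
        exact mul_le_one₀ h4 (by positivity) h3
      _ ≤ ‖x - y‖ := by simpa using hab
  linarith [norm_add_le (a⁻¹ • (x - y)) ((a⁻¹ - b⁻¹) • y)]

/-- A strictly contractive perturbation of the identity is bijective. -/
lemma bijective_id_add_of_lipschitzWith {E : Type*} [NormedAddCommGroup E] [CompleteSpace E]
    {h : E → E} {K : ℝ≥0} (hh : LipschitzWith K h) (hK : K < 1) :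
    Function.Bijective (fun x => x + h x) := by
  constructor
  · intro x y hxy
    by_contra hne
    have h1 : dist (h x) (h y) ≤ K * dist x y := hh.dist_le_mul x y
    have h2 : dist (h x) (h y) = dist x y := by
      have h3 : h x - h y = y - x := by
        have h4 : x + h x = y + h y := hxy
        rw [sub_eq_sub_iff_add_eq_add, add_comm, h4]
      rw [dist_eq_norm, h3, dist_comm, dist_eq_norm]
    have h3 : 0 < dist x y := dist_pos.2 hne
    have h4 : (K : ℝ) < 1 := by exact_mod_cast hK
    nlinarith
  · intro y
    have hc : ContractingWith K (fun x => y - h x) :=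
      ⟨hK, LipschitzWith.of_dist_le_mul fun a b => by
        rw [dist_sub_left]; exact hh.dist_le_mul a b⟩
    refine ⟨hc.fixedPoint, ?_⟩
    have : y - h hc.fixedPoint = hc.fixedPoint := hc.fixedPoint_isFixedPt
    change hc.fixedPoint + h hc.fixedPoint = y
    rw [sub_eq_iff_eq_add] at this
    exact this.symm

/-- `t ↦ det (1 + t A)` is a polynomial of degree at most the dimension. -/
lemma exists_polynomial_eval_eq_det_one_add_smul {E : Type*} [NormedAddCommGroup E]
    [NormedSpace ℝ E] [FiniteDimensional ℝ E] (A : E →L[ℝ] E) :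
    ∃ q : Polynomial ℝ, q.natDegree ≤ Module.finrank ℝ E ∧
      ∀ t : ℝ, q.eval t = (1 + t • A).det := by
  classical
  let b := Module.finBasis ℝ E
  let M := LinearMap.toMatrix b b (A : E →ₗ[ℝ] E)
  refine ⟨((Polynomial.X : Polynomial ℝ) • M.map Polynomial.C
    + (1 : Matrix _ _ ℝ).map Polynomial.C).det, ?_, fun t => ?_⟩
  · simpa using Polynomial.natDegree_det_X_add_C_le M 1
  · have h1 : (1 + t • A).det = LinearMap.det ((1 + t • A : E →L[ℝ] E) : E →ₗ[ℝ] E) := rfl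
    rw [h1, ← LinearMap.det_toMatrix b]
    have h2 : LinearMap.toMatrix b b ((1 + t • A : E →L[ℝ] E) : E →ₗ[ℝ] E) = t • M + 1 := by
      have h3 : ((1 + t • A : E →L[ℝ] E) : E →ₗ[ℝ] E) = t • (A : E →ₗ[ℝ] E) + LinearMap.id := by
        ext x; simp [add_comm]
      rw [h3, map_add, map_smul, LinearMap.toMatrix_id]
    rw [h2, ← Polynomial.coe_evalRingHom, RingHom.map_det]
    congr 1
    ext i j
    by_cases hij : i = j <;> simp [hij] <;> exact mul_comm _ _

/-- Along the segment from `1` to `1 + A` every operator is injective, since `‖t A x‖ < ‖x‖` for `x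
≠ 0`; so the determinant, which is `1` at the start, cannot change sign. -/
lemma det_one_add_pos {E : Type*} [NormedAddCommGroup E] [NormedSpace ℝ E]
    [FiniteDimensional ℝ E] {A : E →L[ℝ] E} (hA : ‖A‖ < 1) : 0 < (1 + A).det := by
  have hne : ∀ t ∈ Set.Icc (0 : ℝ) 1, (1 + t • A).det ≠ 0 := by
    intro t ht h0
    have hinj : Function.Injective ((1 + t • A : E →L[ℝ] E) : E →ₗ[ℝ] E) := by
      rw [injective_iff_map_eq_zero]
      intro x hx
      by_contra hx0
      have h1 : x = -(t • A x) := by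
        have : x + t • A x = 0 := by simpa using hx
        exact eq_neg_of_add_eq_zero_left this
      have h2 : ‖x‖ ≤ ‖A x‖ := by
        conv_lhs => rw [h1]
        rw [norm_neg, norm_smul, Real.norm_of_nonneg ht.1]
        exact mul_le_of_le_one_left (norm_nonneg _) ht.2
      have h3 := A.le_opNorm x
      have h4 : 0 < ‖x‖ := norm_pos_iff.2 hx0
      nlinarith
    have hu : IsUnit ((1 + t • A : E →L[ℝ] E) : E →ₗ[ℝ] E) :=
      (Module.End.isUnit_iff _).2 ⟨hinj, LinearMap.injective_iff_surjective.1 hinj⟩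
    exact (LinearMap.isUnit_iff_isUnit_det _ |>.1 hu).ne_zero h0
  have hcont : ContinuousOn (fun t : ℝ => (1 + t • A).det) (Set.Icc 0 1) :=
    (ContinuousLinearMap.continuous_det.comp (by fun_prop)).continuousOn
  by_contra hneg
  have h1 : (0 : ℝ) ∈ Set.Icc ((1 + (1 : ℝ) • A).det) ((1 + (0 : ℝ) • A).det) := by
    refine ⟨by simpa using hneg, ?_⟩
    have : ((1 : E →L[ℝ] E)).det = 1 := LinearMap.det_id
    simp [this]
  obtain ⟨t, ht, h0⟩ := intermediate_value_Icc' zero_le_one hcont h1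
  exact hne t ht h0

/-- Evaluation at `1` of a polynomial of degree at most `d` is a weighted sum, with total weight
one, of its values at `d + 1` given nodes. -/
lemma exists_weights_eval_one (d : ℕ) {v : ℕ → ℝ} (hv : Function.Injective v) :
    ∃ w : ℕ → ℝ, ∑ i ∈ Finset.range (d + 1), w i = 1 ∧ ∀ q : Polynomial ℝ, q.natDegree ≤ d →
      q.eval 1 = ∑ i ∈ Finset.range (d + 1), w i * q.eval (v i) := by
  refine ⟨fun i => (Lagrange.basis (Finset.range (d + 1)) v i).eval 1, ?_, fun q hq => ?_⟩
  · rw [← Polynomial.eval_finsetSum, Lagrange.sum_basis hv.injOn (by simp), Polynomial.eval_one]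
  · have hdeg : q.degree < (Finset.range (d + 1)).card := by
      rw [Finset.card_range]
      refine Polynomial.degree_le_natDegree.trans_lt ?_
      exact_mod_cast Nat.lt_succ_of_le hq
    conv_lhs => rw [Lagrange.eq_interpolate (s := Finset.range (d + 1)) (v := v) hv.injOn hdeg]
    rw [Lagrange.interpolate_apply, Polynomial.eval_finsetSum]
    simp [mul_comm]

/-- There is no retraction of the closed unit ball onto the unit sphere that is Lipschitz on the
ball and differentiable in its interior. -/
theorem no_lipschitz_differentiable_retraction {E : Type*} [NormedAddCommGroup E]
    [InnerProductSpace ℝ E] [FiniteDimensional ℝ E] {r : E → E} {L : ℝ≥0}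
    (hL : LipschitzOnWith L r (closedBall 0 1))
    (hd : ∀ x ∈ ball (0 : E) 1, DifferentiableAt ℝ r x)
    (hr : ∀ x ∈ closedBall (0 : E) 1, ‖r x‖ = 1) (hs : ∀ x, ‖x‖ = 1 → r x = x) : False := by
  borelize E
  let μ : Measure E := Measure.addHaar
  let π : E → E := fun x => (max 1 ‖x‖)⁻¹ • x
  have hπ_mem : ∀ x, π x ∈ closedBall (0 : E) 1 := by
    intro x
    rw [mem_closedBall_zero_iff, norm_smul, Real.norm_of_nonneg (by positivity),
      inv_mul_le_iff₀ (by positivity), mul_one]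
    exact le_max_right _ _
  have hπ_ball : ∀ x, ‖x‖ ≤ 1 → π x = x := by
    intro x hx
    simp [π, max_eq_left hx]
  have hπ_out : ∀ x, 1 ≤ ‖x‖ → ‖π x‖ = 1 := by
    intro x hx
    have : 0 < ‖x‖ := by linarith
    simp only [π, max_eq_right hx, norm_smul, norm_inv, norm_norm]
    field_simp
  -- The displacement `r - id` on the ball, extended by zero. Being Lipschitz on all of `E`, it
  -- makes `x + t h x` a bijection of `E` for small `t`.
  let h : E → E := fun x => r (π x) - π x
  have hh : LipschitzWith (L * 2 + 2) h := by
    have h1 : LipschitzWith (L * 2) (fun x => r (π x)) := by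
      rw [← lipschitzOnWith_univ]
      exact hL.comp (lipschitzWith_radial_retraction.lipschitzOnWith) (fun x _ => hπ_mem x)
    exact h1.sub lipschitzWith_radial_retraction
  have hh_out : ∀ x, 1 ≤ ‖x‖ → h x = 0 := fun x hx => by
    simp only [h]; rw [hs _ (hπ_out x hx), sub_self]
  have hh_ball : ∀ x, ‖x‖ ≤ 1 → h x = r x - x := fun x hx => by
    simp only [h]; rw [hπ_ball x hx]
  have hfd : ∀ x ∈ ball (0 : E) 1, HasFDerivAt h (fderiv ℝ r x - 1) x := by
    intro x hx
    have h1 : HasFDerivAt (fun x => r x - x) (fderiv ℝ r x - 1) x :=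
      (hd x hx).hasFDerivAt.sub (hasFDerivAt_id x)
    refine h1.congr_of_eventuallyEq ?_
    filter_upwards [isOpen_ball.mem_nhds hx] with y hy
    exact hh_ball y (by simpa using (mem_ball_zero_iff.1 hy).le)
  let A : E → E →L[ℝ] E := fun x => fderiv ℝ r x - 1
  set M : ℝ≥0 := L * 2 + 2 with hM
  have hA : ∀ x ∈ ball (0 : E) 1, ‖A x‖ ≤ M := fun x hx => (hfd x hx).le_of_lipschitz hh
  have hMpos : (0 : ℝ) < M := by rw [hM]; push_cast; positivity
  -- for small `t`, the map `x ↦ x + t • h x` preserves the volume of the ball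
  have hvol : ∀ t : ℝ, 0 < t → t * M < 1 →
      IntegrableOn (fun x => (1 + t • A x).det) (ball 0 1) μ ∧
        ∫ x in ball (0 : E) 1, (1 + t • A x).det ∂μ = μ.real (ball 0 1) := by
    intro t ht htM
    let F : E → E := fun x => x + t • h x
    have hlip : LipschitzWith (t.toNNReal * M) (fun x => t • h x) := by
      refine LipschitzWith.of_dist_le_mul fun x y => ?_
      rw [dist_smul₀, Real.norm_of_nonneg ht.le, NNReal.coe_mul, Real.coe_toNNReal _ ht.le, mul_assoc]
      exact mul_le_mul_of_nonneg_left (hh.dist_le_mul x y) ht.le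
    have hbij : Function.Bijective F := by
      refine bijective_id_add_of_lipschitzWith hlip ?_
      rw [← NNReal.coe_lt_coe, NNReal.coe_mul, Real.coe_toNNReal _ ht.le]
      exact_mod_cast htM
    have hM2 : (2 : ℝ) ≤ M := by rw [hM]; push_cast; linarith [mul_nonneg L.2 (zero_le_two (α := ℝ))]
    have ht1 : t < 1 := by nlinarith
    -- Inside the ball, `F x` is a convex combination of `x` and a unit vector, with positive weight
    -- on `x` because `t < 1`. Outside, `F` is the identity, so the preimage of a point of the ball
    -- lies in the ball.
    have himg : F '' ball 0 1 = ball 0 1 := by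
      ext y
      constructor
      · rintro ⟨x, hx, rfl⟩
        rw [mem_ball_zero_iff] at hx ⊢
        have h1 : F x = (1 - t) • x + t • r x := by
          simp only [F]; rw [hh_ball x hx.le]; module
        have h2 : ‖r x‖ = 1 := hr x (by simpa using hx.le)
        rw [h1]
        calc ‖(1 - t) • x + t • r x‖ ≤ ‖(1 - t) • x‖ + ‖t • r x‖ := norm_add_le _ _
          _ = (1 - t) * ‖x‖ + t := by
            rw [norm_smul, norm_smul, Real.norm_of_nonneg ht.le,
              Real.norm_of_nonneg (by linarith), h2, mul_one]
          _ < 1 := by nlinarith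
      · intro hy
        obtain ⟨x, rfl⟩ := hbij.2 y
        refine ⟨x, ?_, rfl⟩
        by_contra hx
        rw [mem_ball_zero_iff, not_lt] at hx
        have : F x = x := by simp [F, hh_out x hx]
        rw [this, mem_ball_zero_iff] at hy
        linarith
    have hF : ∀ x ∈ ball (0 : E) 1, HasFDerivWithinAt F (1 + t • A x) (ball 0 1) x :=
      fun x hx => ((hasFDerivAt_id x).add ((hfd x hx).const_smul t)).hasFDerivWithinAt
    have hpos : ∀ x ∈ ball (0 : E) 1, 0 < (1 + t • A x).det := by
      intro x hx
      refine det_one_add_pos ?_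
      rw [norm_smul, Real.norm_of_nonneg ht.le]
      exact (mul_le_mul_of_nonneg_left (hA x hx) ht.le).trans_lt htM
    have hcongr : Set.EqOn (fun x => |(1 + t • A x).det| • (1 : ℝ))
        (fun x => (1 + t • A x).det) (ball 0 1) := fun x hx => by
      simp [abs_of_pos (hpos x hx)]
    constructor
    · rw [← integrableOn_congr_fun hcongr measurableSet_ball,
        ← integrableOn_image_iff_integrableOn_abs_det_fderiv_smul μ measurableSet_ball hF
          hbij.1.injOn (fun _ => (1 : ℝ)), himg]
      exact integrableOn_const measure_ball_lt_top.ne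
    · rw [← setIntegral_congr_fun measurableSet_ball hcongr,
        ← integral_image_eq_integral_abs_det_fderiv_smul μ measurableSet_ball hF
          hbij.1.injOn (fun _ => (1 : ℝ)), himg]
      simp
  -- Differentiating `‖r‖² = 1` shows that the range of `Dr` is orthogonal to `r x ≠ 0`, so `Dr` is
  -- not surjective.
  have hdet0 : ∀ x ∈ ball (0 : E) 1, (1 + A x).det = 0 := by
    intro x hx
    have hA1 : 1 + A x = fderiv ℝ r x := by simp [A]
    rw [hA1]
    by_contra hne
    have hu : IsUnit ((fderiv ℝ r x : E →L[ℝ] E) : E →ₗ[ℝ] E) :=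
      (LinearMap.isUnit_iff_isUnit_det _).2 (isUnit_iff_ne_zero.2 hne)
    obtain ⟨v, hv⟩ := ((Module.End.isUnit_iff _).1 hu).2 (r x)
    have h1 : HasFDerivAt (fun y => inner ℝ (r y) (r y)) _ x :=
      (hd x hx).hasFDerivAt.inner ℝ (hd x hx).hasFDerivAt
    have h2 : HasFDerivAt (fun y => inner ℝ (r y) (r y)) (0 : E →L[ℝ] ℝ) x := by
      refine (hasFDerivAt_const (1 : ℝ) x).congr_of_eventuallyEq ?_
      filter_upwards [isOpen_ball.mem_nhds hx] with y hy
      rw [real_inner_self_eq_norm_sq, hr y (ball_subset_closedBall hy), one_pow]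
    have h3 := congrArg (fun T : E →L[ℝ] ℝ => T v) (h1.unique h2)
    have hv' : fderiv ℝ r x v = r x := hv
    have h4 := hr x (ball_subset_closedBall hx)
    simp [hv', h4] at h3
  -- Distinct nodes in the range where `hvol` applies: `v i * M = 1 / (i + 2)`. A shift by one would
  -- give the value `1` at `i = 0`, which is not strictly below the bound.
  let v : ℕ → ℝ := fun i => (M : ℝ)⁻¹ / (i + 2)
  have hv_inj : Function.Injective v := by
    intro i j hij
    have h1 : (M : ℝ)⁻¹ / (i + 2) = (M : ℝ)⁻¹ / (j + 2) := hij
    rw [div_eq_div_iff (by positivity) (by positivity)] at h1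
    have h2 := mul_left_cancel₀ (inv_ne_zero hMpos.ne') h1
    have h3 : (i : ℝ) = j := by linarith
    exact_mod_cast h3
  have hv_pos : ∀ i, 0 < v i := fun i => by positivity
  have hv_lt : ∀ i, v i * M < 1 := fun i => by
    have : v i * M = 1 / (i + 2) := by simp only [v]; field_simp
    rw [this, div_lt_one (by positivity)]
    linarith [Nat.cast_nonneg (α := ℝ) i]
  obtain ⟨w, hw1, hw⟩ := exists_weights_eval_one (Module.finrank ℝ E) hv_inj
  have hsum : ∀ x ∈ ball (0 : E) 1, ∑ i ∈ Finset.range (Module.finrank ℝ E + 1),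
      w i * (1 + v i • A x).det = 0 := by
    intro x hx
    obtain ⟨q, hq, hqe⟩ := exists_polynomial_eval_eq_det_one_add_smul (A x)
    have h1 := hw q hq
    simp only [hqe, one_smul] at h1
    rw [← h1, hdet0 x hx]
  -- Interpolation extrapolates from small `t` to `t = 1`: this integral is zero pointwise, but
  -- `hvol` and total weight one make it the volume of the ball.
  have h0 : ∫ x in ball (0 : E) 1, ∑ i ∈ Finset.range (Module.finrank ℝ E + 1),
      w i * (1 + v i • A x).det ∂μ = 0 := by
    rw [setIntegral_congr_fun measurableSet_ball hsum]; simp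
  rw [integral_finsetSum _ fun i _ => ((hvol (v i) (hv_pos i) (hv_lt i)).1.const_mul (w i))] at h0
  simp only [integral_const_mul, (hvol _ (hv_pos _) (hv_lt _)).2] at h0
  rw [← Finset.sum_mul, hw1, one_mul] at h0
  exact (ENNReal.toReal_pos (measure_ball_pos μ (0 : E) one_pos).ne' measure_ball_lt_top.ne).ne' h0

/-! ### Brouwer's theorem for smooth maps -/

/-- **Brouwer's fixed point theorem** for smooth maps into the closed unit ball. -/
theorem exists_fixedPoint_of_contDiff {E : Type*} [NormedAddCommGroup E] [InnerProductSpace ℝ E]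
    [FiniteDimensional ℝ E] {f : E → E} (hf : ContDiff ℝ 1 f) (hb : ∀ x, ‖f x‖ ≤ 1) :
    ∃ x, f x = x := by
  by_contra! hne
  -- The ray from `f x` through `x` meets the sphere at `r x = x + s w`, where `s` is the larger
  -- root of `‖w‖² s² + 2 b s + ‖x‖² - 1 = 0` and `D` is a quarter of its discriminant.
  let w : E → E := fun x => x - f x
  have hw0 : ∀ x, w x ≠ 0 := fun x hx => hne x (sub_eq_zero.1 hx).symm
  let b : E → ℝ := fun x => inner ℝ x (w x)
  let D : E → ℝ := fun x => b x ^ 2 + ‖w x‖ ^ 2 * (1 - ‖x‖ ^ 2)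
  let s : E → ℝ := fun x => (Real.sqrt (D x) - b x) / ‖w x‖ ^ 2
  let r : E → E := fun x => x + s x • w x
  have hwc : ContDiff ℝ 1 w := contDiff_id.sub hf
  have hbc : ContDiff ℝ 1 b := contDiff_id.inner ℝ hwc
  have hnw : ContDiff ℝ 1 (fun x => ‖w x‖ ^ 2) := hwc.norm_sq ℝ
  have hDc : ContDiff ℝ 1 D :=
    (hbc.pow 2).add (hnw.mul (contDiff_const.sub (contDiff_id.norm_sq ℝ)))
  -- Positivity of `b` on the sphere does two things: it keeps `D` away from zero there, so the
  -- square root is smooth, and it gives `√(b²) = b`, so `r` fixes the sphere.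
  have hbpos : ∀ x, ‖x‖ = 1 → 0 < b x := by
    intro x hx
    have h1 : b x = 1 - inner ℝ x (f x) := by
      simp only [b, w, inner_sub_right, real_inner_self_eq_norm_sq, hx]; norm_num
    have h2 : inner ℝ x (f x) ≤ 1 :=
      (real_inner_le_norm x (f x)).trans (by rw [hx, one_mul]; exact hb x)
    have h3 : inner ℝ x (f x) ≠ 1 := by
      intro h3
      have h4 : ‖x - f x‖ ^ 2 ≤ 0 := by
        rw [norm_sub_sq_real, h3, hx]
        nlinarith [hb x, norm_nonneg (f x)]
      have h5 : ‖x - f x‖ = 0 := by nlinarith [norm_nonneg (x - f x)]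
      exact hw0 x (norm_eq_zero.1 h5)
    rw [h1]
    linarith [lt_of_le_of_ne h2 h3]
  have hDpos : ∀ x, ‖x‖ ≤ 1 → 0 < D x := by
    intro x hx
    rcases hx.lt_or_eq with hlt | heq
    · have h1 : 0 < ‖w x‖ := norm_pos_iff.2 (hw0 x)
      have h2 : 0 < 1 - ‖x‖ ^ 2 := by nlinarith [norm_nonneg x]
      have h3 : 0 < ‖w x‖ ^ 2 * (1 - ‖x‖ ^ 2) := by positivity
      exact add_pos_of_nonneg_of_pos (sq_nonneg _) h3
    · have := hbpos x heq
      have h3 : D x = b x ^ 2 := by simp [D, heq]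
      rw [h3]; positivity
  have hrc : ∀ x, ‖x‖ ≤ 1 → ContDiffAt ℝ 1 r x := by
    intro x hx
    have h1 : ContDiffAt ℝ 1 s x :=
      ((hDc.contDiffAt.sqrt (hDpos x hx).ne').sub hbc.contDiffAt).div hnw.contDiffAt
        (by have := hw0 x; simpa using this)
    exact contDiffAt_id.add (h1.smul hwc.contDiffAt)
  have hloc : LocallyLipschitzOn (closedBall (0 : E) 1) r := by
    intro x hx
    obtain ⟨C, t, ht, hC⟩ := (hrc x (mem_closedBall_zero_iff.1 hx)).exists_lipschitzOnWith
    exact ⟨C, t, mem_nhdsWithin_of_mem_nhds ht, hC⟩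
  obtain ⟨L, hL⟩ := hloc.exists_lipschitzOnWith_of_compact (isCompact_closedBall 0 1)
  refine no_lipschitz_differentiable_retraction hL (fun x hx => ?_) (fun x hx => ?_)
    (fun x hx => ?_)
  · exact (hrc x (mem_ball_zero_iff.1 hx).le).differentiableAt one_ne_zero
  · have hD := (hDpos x (mem_closedBall_zero_iff.1 hx)).le
    have hw := norm_pos_iff.2 (hw0 x)
    have hsq : ‖r x‖ ^ 2 = 1 := by
      have h1 : ‖r x‖ ^ 2 = ‖x‖ ^ 2 + 2 * s x * b x + s x ^ 2 * ‖w x‖ ^ 2 := by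
        simp only [r, b]
        rw [norm_add_sq_real, real_inner_smul_right, norm_smul, mul_pow, Real.norm_eq_abs, sq_abs]
        ring
      have h2 : s x * ‖w x‖ ^ 2 = Real.sqrt (D x) - b x := by
        simp only [s]; field_simp
      have h3 : Real.sqrt (D x) ^ 2 = b x ^ 2 + ‖w x‖ ^ 2 * (1 - ‖x‖ ^ 2) := Real.sq_sqrt hD
      have h4 : Real.sqrt (D x) = s x * ‖w x‖ ^ 2 + b x := by linarith
      rw [h4] at h3
      have h5 : ‖w x‖ ^ 2 * (‖r x‖ ^ 2 - 1) = 0 := by rw [h1]; linear_combination h3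
      have h6 : ‖w x‖ ^ 2 ≠ 0 := by positivity
      have h7 := (mul_eq_zero.1 h5).resolve_left h6
      linarith
    nlinarith [norm_nonneg (r x)]
  · have h1 : D x = b x ^ 2 := by simp [D, hx]
    have h2 : s x = 0 := by
      simp only [s]; rw [h1, Real.sqrt_sq (hbpos x hx).le, sub_self, zero_div]
    simp [r, h2]

/-- Brouwer's fixed point theorem for smooth bounded maps of a Euclidean space. -/
theorem exists_fixedPoint_of_contDiff_of_bounded {E : Type*} [NormedAddCommGroup E]
    [InnerProductSpace ℝ E] [FiniteDimensional ℝ E] {f : E → E} (hf : ContDiff ℝ 1 f) {R : ℝ}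
    (hR : 0 < R) (hb : ∀ x, ‖f x‖ ≤ R) : ∃ x, f x = x := by
  obtain ⟨x, hx⟩ := exists_fixedPoint_of_contDiff (f := fun x => R⁻¹ • f (R • x))
    ((hf.comp (contDiff_id.const_smul R)).const_smul R⁻¹) (fun x => by
      rw [norm_smul, norm_inv, Real.norm_of_nonneg hR.le, inv_mul_le_iff₀ hR, mul_one]
      exact hb _)
  exact ⟨R • x, by rwa [inv_smul_eq_iff₀ hR.ne'] at hx⟩

/-! ### Kakutani's theorem -/

/-- **Kakutani's fixed point theorem** for set-valued maps of a Euclidean space with uniformly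
bounded values. -/
theorem exists_mem_self_of_isClosed_graph {E : Type*} [NormedAddCommGroup E]
    [InnerProductSpace ℝ E] [FiniteDimensional ℝ E] {B : E → Set E} {R : ℝ}
    (hne : ∀ x, (B x).Nonempty) (hconv : ∀ x, Convex ℝ (B x))
    (hbdd : ∀ x, B x ⊆ closedBall 0 R) (hgraph : IsClosed {p : E × E | p.2 ∈ B p.1}) :
    ∃ x, x ∈ B x := by
  by_contra! hno
  have hclosed : ∀ x, IsClosed (B x) := fun x =>
    hgraph.preimage (Continuous.prodMk_right x)
  -- locally, a half space separates the values from the points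
  have hsep : ∀ x, ∃ (l : E →L[ℝ] ℝ) (c : ℝ), ∀ᶠ y in 𝓝 x, c < l y ∧ ∀ z ∈ B y, l z < c := by
    intro x
    obtain ⟨l, c, h1, h2⟩ := geometric_hahn_banach_closed_point (hconv x) (hclosed x) (hno x)
    refine ⟨l, c, ?_⟩
    have hx : ∀ᶠ y in 𝓝 x, c < l y := (l.continuous.tendsto x).eventually_const_lt h2
    -- The closed graph excludes bad pairs near each `(x, z)`; compactness of the ball gives one
    -- neighbourhood of `x` valid for all `z`.
    have hB : ∀ᶠ y in 𝓝 x, ∀ z ∈ closedBall (0 : E) R, ¬ (z ∈ B y ∧ c ≤ l z) := by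
      refine (isCompact_closedBall (0 : E) R).eventually_forall_of_forall_eventually ?_
      intro z _
      have hcl : IsClosed {p : E × E | p.2 ∈ B p.1 ∧ c ≤ l p.2} :=
        hgraph.inter (isClosed_le continuous_const (l.continuous.comp continuous_snd))
      exact hcl.isOpen_compl.mem_nhds (fun h => (h1 z h.1).not_ge h.2)
    filter_upwards [hx, hB] with y hy hBy
    exact ⟨hy, fun z hz => not_le.1 fun hle => hBy z (hbdd y hz) ⟨hz, hle⟩⟩
  -- approximate fixed points
  have happrox : ∀ ε > 0, ∃ x ∈ closedBall (0 : E) R, x ∈ convexHull ℝ (⋃ y ∈ ball x ε, B y) := by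
    intro ε hε
    -- A value of `B` at `x` belongs to the hull for every point within `ε` of `x`, so constants are
    -- local selections and a partition of unity glues them into a smooth one, to which Brouwer
    -- applies.
    obtain ⟨g, hg⟩ := exists_contMDiffMap_forall_mem_convex_of_local_const (n := 1) 𝓘(ℝ, E)
      (t := fun x : E => convexHull ℝ (⋃ y ∈ ball x ε, B y)) (fun x => convex_convexHull ℝ _)
      (fun x => by
        obtain ⟨c, hc⟩ := hne x
        refine ⟨c, ?_⟩
        filter_upwards [ball_mem_nhds x hε] with y hy
        refine subset_convexHull ℝ _ (Set.mem_biUnion ?_ hc)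
        rwa [mem_ball_comm])
    have hgR : ∀ x, g x ∈ closedBall (0 : E) R := fun x =>
      convexHull_min (Set.iUnion₂_subset fun y _ => hbdd y) (convex_closedBall 0 R) (hg x)
    obtain ⟨x, hx⟩ := exists_fixedPoint_of_contDiff_of_bounded (f := g) (R := max R 1)
      g.contMDiff.contDiff (by positivity)
      (fun x => (mem_closedBall_zero_iff.1 (hgR x)).trans (le_max_left _ _))
    refine ⟨x, ?_, ?_⟩
    · have := hgR x; rwa [hx] at this
    · have := hg x; rwa [hx] at this
  choose u huR hu using fun k : ℕ => happrox (1 / ((k : ℝ) + 1)) (by positivity)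
  obtain ⟨x, _, φ, hφ, hlim⟩ := (isCompact_closedBall (0 : E) R).tendsto_subseq huR
  obtain ⟨l, c, hlc⟩ := hsep x
  obtain ⟨δ, hδ, hball⟩ := Metric.eventually_nhds_iff_ball.1 hlc
  -- With both distances below `δ / 2`, all of the hull at `u (φ k)` comes from values at points of
  -- `ball x δ`, hence lies in `l < c`, while `u (φ k)` itself lies in `c < l`.
  have h1 : ∀ᶠ k in Filter.atTop, u (φ k) ∈ ball x (δ / 2) :=
    hlim.eventually (ball_mem_nhds x (half_pos hδ))
  have h2 : ∀ᶠ k in Filter.atTop, 1 / (((φ k : ℕ) : ℝ) + 1) < δ / 2 :=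
    (tendsto_one_div_add_atTop_nhds_zero_nat.comp hφ.tendsto_atTop).eventually_lt_const
      (half_pos hδ)
  obtain ⟨k, hk1, hk2⟩ := (h1.and h2).exists
  have hk3 : c < l (u (φ k)) := (hball _ (ball_subset_ball (by linarith) hk1)).1
  have hk4 : convexHull ℝ (⋃ y ∈ ball (u (φ k)) (1 / (((φ k : ℕ) : ℝ) + 1)), B y)
      ⊆ {z | l z < c} := by
    refine convexHull_min (Set.iUnion₂_subset fun y hy z hz => ?_)
      (convex_halfSpace_lt l.toLinearMap.isLinear c)
    refine (hball y ?_).2 z hz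
    rw [mem_ball] at hy hk1 ⊢
    linarith [dist_triangle y (u (φ k)) x]
  exact lt_asymm hk3 (hk4 (hu (φ k)))

/-! ### Projection, pseudo-continuity and hemicontinuity -/

/-- A closed convex subset of a Hilbert space admits a continuous nearest-point selection. -/
lemma exists_continuous_metricProj {E : Type*} [NormedAddCommGroup E] [InnerProductSpace ℝ E]
    [CompleteSpace E] {A : Set E} (hne : A.Nonempty) (hcl : IsClosed A) (hconv : Convex ℝ A) :
    ∃ P : E → E, Continuous P ∧ ∀ z, P z ∈ metricProj A z := by
  choose P hPA hP using exists_norm_eq_iInf_of_complete_convex hne hcl.isComplete hconv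
  have hin : ∀ z, ∀ w ∈ A, inner ℝ (z - P z) (w - P z) ≤ 0 := fun z =>
    (norm_eq_iInf_iff_real_inner_le_zero hconv (hPA z)).1 (hP z)
  refine ⟨P, ?_, fun z => ⟨hPA z, fun x hx => ?_⟩⟩
  · refine (LipschitzWith.of_dist_le_mul (K := 1) fun x y => ?_).continuous
    rw [NNReal.coe_one, one_mul, dist_eq_norm, dist_eq_norm]
    -- Adding the variational inequalities at `x` and `y`, each tested at the other's projection,
    -- gives `‖P x - P y‖² ≤ ⟨x - y, P x - P y⟩`, whence `P` is nonexpansive.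
    have h1 := hin x (P y) (hPA y)
    have h2 := hin y (P x) (hPA x)
    have h3 : inner ℝ (x - P x) (P y - P x) + inner ℝ (y - P y) (P x - P y)
        = ‖P x - P y‖ ^ 2 - inner ℝ (x - y) (P x - P y) := by
      rw [← neg_sub (P x) (P y), inner_neg_right, ← real_inner_self_eq_norm_sq]
      simp only [inner_sub_left]
      ring
    have h4 := real_inner_le_norm (x - y) (P x - P y)
    rcases (norm_nonneg (P x - P y)).eq_or_lt with h5 | h5
    · rw [← h5]; exact norm_nonneg _
    · nlinarith
  · rw [hP z]
    exact ciInf_le ⟨0, by rintro _ ⟨w, rfl⟩; exact norm_nonneg _⟩ (⟨x, hx⟩ : A)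

/-- A pseudo-continuous function on a connected space induces a continuous strict preference. -/
lemma PseudoContinuous.isOpen_lt {X : Type*} [TopologicalSpace X] [PreconnectedSpace X]
    {f : X → ℝ} (hf : PseudoContinuous f) : IsOpen {p : X × X | f p.1 < f p.2} := by
  have hlt : ∀ y, IsOpen {x | f x < f y} := fun y => isOpen_iff_mem_nhds.2 fun x hx => by
    obtain ⟨V, hV, h⟩ := hf.2 x y hx
    exact Filter.mem_of_superset hV h
  have hgt : ∀ y, IsOpen {x | f y < f x} := fun y => isOpen_iff_mem_nhds.2 fun x hx => by
    obtain ⟨V, hV, h⟩ := hf.1 x y (neg_lt_neg hx)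
    exact Filter.mem_of_superset hV fun z hz => neg_lt_neg_iff.1 (h z hz)
  rw [isOpen_iff_mem_nhds]
  rintro ⟨a, b⟩ (hab : f a < f b)
  by_cases hc : ∃ c, f a < f c ∧ f c < f b
  · obtain ⟨c, hac, hcb⟩ := hc
    refine Filter.mem_of_superset (prod_mem_nhds ((hlt c).mem_nhds hac) ((hgt c).mem_nhds hcb)) ?_
    rintro ⟨x, y⟩ ⟨hx, hy⟩
    exact lt_trans (Set.mem_ofPred.1 hx) (Set.mem_ofPred.1 hy)
  -- With no value strictly between `f a` and `f b`, the open sets `f < f b` and `f a < f` would be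
  -- disjoint, non-empty and cover the space, against connectedness.
  · exfalso
    push Not at hc
    obtain ⟨z, -, hz1, hz2⟩ := isPreconnected_univ {x | f x < f b} {x | f a < f x} (hlt b) (hgt a)
      (fun x _ => (lt_or_ge (f a) (f x)).elim Or.inr fun h => Or.inl (h.trans_lt hab))
      ⟨a, trivial, hab⟩ ⟨b, trivial, hab⟩
    exact (hc z hz2).not_gt hz1

/-- A function with relatively open strict upper level sets attains its minimum on a compact set. -/
lemma IsCompact.exists_forall_le_of_isOpen_lt {X : Type*} [TopologicalSpace X] {s : Set X}
    (hs : IsCompact s) (hne : s.Nonempty) {f : X → ℝ} (hf : ∀ a, IsOpen {x | f a < f x}) :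
    ∃ x ∈ s, ∀ y ∈ s, f x ≤ f y := by
  by_contra! h
  have : Nonempty s := hne.to_subtype
  -- Without a minimiser, the strict upper level sets of points of `s` cover `s`. They form a chain,
  -- so a single one covers `s`, including its own `a`.
  obtain ⟨a, ha⟩ := hs.elim_directed_cover (fun a : s => {x | f a < f x}) (fun a => hf a)
    (fun x hx => by
      obtain ⟨y, hy, hyx⟩ := h x hx
      exact Set.mem_iUnion.2 ⟨⟨y, hy⟩, hyx⟩)
    (fun a b => by
      rcases le_total (f a) (f b) with hab | hab
      · exact ⟨a, subset_rfl, fun x hx => hab.trans_lt hx⟩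
      · exact ⟨b, fun x hx => hab.trans_lt hx, subset_rfl⟩)
  exact lt_irrefl (f a) (ha a.2)

/-- An upper hemicontinuous map with closed values in a regular space has a closed graph. -/
lemma UpperHemicontinuous.isClosed_setOf_mem {X Y : Type*} [TopologicalSpace X]
    [TopologicalSpace Y] [RegularSpace Y] {T : X → Set Y} (hT : UpperHemicontinuous T)
    (hcl : ∀ x, IsClosed (T x)) : IsClosed {p : X × Y | p.2 ∈ T p.1} := by
  rw [← isOpen_compl_iff, isOpen_iff_mem_nhds]
  rintro ⟨x, y⟩ (hy : y ∉ T x)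
  obtain ⟨U, V, hU, hV, hTU, hyV, hdisj⟩ : SeparatedNhds (T x) {y} := by
    rw [separatedNhds_iff_disjoint, nhdsSet_singleton]
    exact (RegularSpace.regular (hcl x) hy)
  have h1 := hT.forall_isOpen x U hU hTU
  refine Filter.mem_of_superset (prod_mem_nhds h1 (hV.mem_nhds (hyV rfl))) ?_
  rintro ⟨x', y'⟩ ⟨hx', hy'⟩ (hmem : y' ∈ T x')
  exact Set.disjoint_left.1 hdisj (hx' hmem) hy'

/-! ### Best replies -/

section deviate

variable {N : Type*} [DecidableEq N] {n : N → ℕ}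

lemma continuous_deviate (ν : N) :
    Continuous fun p : JointSpace n × EuclideanSpace ℝ (Fin (n ν)) => deviate p.1 ν p.2 :=
  (PiLp.continuous_toLp 2 _).comp
    (((PiLp.continuous_ofLp 2 _).comp continuous_fst).update ν continuous_snd)

lemma deviate_self (x : JointSpace n) (ν : N) : deviate x ν (x ν) = x := by
  simp [deviate]

end deviate

/-- The product of the best replies against `y` when player `ν` is confined to `T ν y`. -/
def bestReplies {N : Type*} [DecidableEq N] {n : N → ℕ} (θ : N → JointSpace n → ℝ)
    (T : ∀ ν, JointSpace n → Set (EuclideanSpace ℝ (Fin (n ν)))) (y : JointSpace n) :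
    Set (JointSpace n) :=
  {z | ∀ ν, z ν ∈ T ν y ∧ ∀ w ∈ T ν y, θ ν (deviate y ν (z ν)) ≤ θ ν (deviate y ν w)}

section bestReplies

variable {N : Type*} [DecidableEq N] {n : N → ℕ} {θ : N → JointSpace n → ℝ}
  {T : ∀ ν, JointSpace n → Set (EuclideanSpace ℝ (Fin (n ν)))}

/-- Openness is joint in the opponents' play and both own strategies. Fixing the first two variables
yields existence of best replies; the joint form is what the closed graph needs. -/
lemma isOpen_setOf_deviate_lt [Fintype N] {ν : N} (hθ : PseudoContinuous (θ ν)) :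
    IsOpen {p : JointSpace n × EuclideanSpace ℝ (Fin (n ν)) × EuclideanSpace ℝ (Fin (n ν)) |
      θ ν (deviate p.1 ν p.2.1) < θ ν (deviate p.1 ν p.2.2)} :=
  hθ.isOpen_lt.preimage
    (((continuous_deviate ν).comp (continuous_fst.prodMk (continuous_fst.comp continuous_snd))).prodMk
      ((continuous_deviate ν).comp (continuous_fst.prodMk (continuous_snd.comp continuous_snd))))

lemma bestReplies_nonempty [Fintype N] (hθ : ∀ ν, PseudoContinuous (θ ν)) {y : JointSpace n}
    (hT : ∀ ν, IsCompact (T ν y)) (hne : ∀ ν, (T ν y).Nonempty) :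
    (bestReplies θ T y).Nonempty := by
  have h : ∀ ν, ∃ z ∈ T ν y, ∀ w ∈ T ν y, θ ν (deviate y ν z) ≤ θ ν (deviate y ν w) := fun ν =>
    (hT ν).exists_forall_le_of_isOpen_lt (hne ν) (f := fun z => θ ν (deviate y ν z)) fun a =>
      (isOpen_setOf_deviate_lt (hθ ν)).preimage
        (continuous_const.prodMk (continuous_const.prodMk continuous_id) :
          Continuous fun z => (y, a, z))
  choose z hz hmin using h
  exact ⟨WithLp.toLp 2 z, fun ν => ⟨hz ν, hmin ν⟩⟩

/-- For each competitor `w`, the replies at least as good as `w` form a sublevel set of a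
quasi-convex function. -/
lemma convex_bestReplies
    (hθ : ∀ ν (x : JointSpace n), QuasiconvexOn ℝ Set.univ (fun z => θ ν (deviate x ν z)))
    {y : JointSpace n} (hT : ∀ ν, Convex ℝ (T ν y)) : Convex ℝ (bestReplies θ T y) := by
  intro a ha b hb s t hs ht hst ν
  refine ⟨hT ν (ha ν).1 (hb ν).1 hs ht hst, fun w hw => ?_⟩
  exact (hθ ν y (θ ν (deviate y ν w)) ⟨trivial, (ha ν).2 w hw⟩ ⟨trivial, (hb ν).2 w hw⟩
    hs ht hst).2

lemma isClosed_graph_bestReplies [Fintype N] (hθ : ∀ ν, PseudoContinuous (θ ν))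
    (hT : ∀ ν, SetValuedContinuous (T ν)) (hcl : ∀ ν y, IsClosed (T ν y)) :
    IsClosed {p : JointSpace n × JointSpace n | p.2 ∈ bestReplies θ T p.1} := by
  have hcoord : ∀ ν, Continuous fun p : JointSpace n × JointSpace n => (p.1, p.2 ν) := fun ν =>
    continuous_fst.prodMk ((PiLp.continuous_apply 2 _ ν).comp continuous_snd)
  have hset : {p : JointSpace n × JointSpace n | p.2 ∈ bestReplies θ T p.1} =
      ⋂ ν, (fun p : JointSpace n × JointSpace n => (p.1, p.2 ν)) ⁻¹'
        ({q | q.2 ∈ T ν q.1} ∩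
          {q | ∀ w ∈ T ν q.1, θ ν (deviate q.1 ν q.2) ≤ θ ν (deviate q.1 ν w)}) := by
    ext p; simp [bestReplies]
  rw [hset]
  refine isClosed_iInter fun ν => IsClosed.preimage (hcoord ν)
    (((hT ν).1.isClosed_setOf_mem (hcl ν)).inter ?_)
  rw [← isOpen_compl_iff, isOpen_iff_mem_nhds]
  rintro ⟨y, z⟩ hyz
  obtain ⟨w, hw, hlt⟩ : ∃ w ∈ T ν y, θ ν (deviate y ν w) < θ ν (deviate y ν z) := by
    simpa using hyz
  have hnhds := (isOpen_setOf_deviate_lt (hθ ν)).mem_nhds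
    (show (y, w, z) ∈ {p : JointSpace n × _ × _ | _} from hlt)
  obtain ⟨U, hU, V, hV, hUV⟩ := mem_nhds_prod_iff.1 hnhds
  obtain ⟨W, hW, Z, hZ, hWZ⟩ := mem_nhds_prod_iff.1 hV
  -- Lower hemicontinuity provides, for `y'` near `y`, a feasible `w'` close to the better reply
  -- `w`; openness of the preference keeps it better than `z'`.
  have hlow : {y' | (T ν y' ∩ interior W).Nonempty} ∈ 𝓝 y :=
    (lowerHemicontinuous_iff_isOpen_inter_nonempty.1 (hT ν).2 _ isOpen_interior).mem_nhds
      ⟨w, hw, mem_interior_iff_mem_nhds.2 hW⟩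
  refine Filter.mem_of_superset (prod_mem_nhds (Filter.inter_mem hU hlow) hZ) ?_
  rintro ⟨y', z'⟩ ⟨⟨hy', w', hw', hwW⟩, hz'⟩ hall
  exact (hall w' hw').not_gt
    (hUV (Set.mk_mem_prod hy' (hWZ (Set.mk_mem_prod (interior_subset hwW) hz'))))

end bestReplies

/-! ### Existence of a projected solution -/

lemma SetValuedContinuous.comp {X Y Z : Type*} [TopologicalSpace X] [TopologicalSpace Y]
    [TopologicalSpace Z] {T : Y → Set Z} (hT : SetValuedContinuous T) {g : X → Y}
    (hg : Continuous g) : SetValuedContinuous fun x => T (g x) :=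
  ⟨upperHemicontinuous_iff_isOpen_preimage_Iic.2 fun u hu =>
      (upperHemicontinuous_iff_isOpen_preimage_Iic.1 hT.1 u hu).preimage hg,
    lowerHemicontinuous_iff_isOpen_inter_nonempty.2 fun u hu =>
      (lowerHemicontinuous_iff_isOpen_inter_nonempty.1 hT.2 u hu).preimage hg⟩

lemma exists_closedBall_of_isBounded_coordinates {N : Type*} [Fintype N] {n : N → ℕ}
    {S : ∀ ν, Set (EuclideanSpace ℝ (Fin (n ν)))} (hS : ∀ ν, Bornology.IsBounded (S ν)) :
    ∃ R : ℝ, jointSet S ⊆ Metric.closedBall 0 R := by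
  have hpi : Bornology.IsBounded (Set.univ.pi S) := Bornology.IsBounded.pi hS
  have hb : Bornology.IsBounded (jointSet S) := by
    refine ((PiLp.antilipschitzWith_ofLp 2 _).isBounded_preimage hpi).subset ?_
    exact fun x hx ν _ => hx ν
  exact hb.subset_closedBall 0

theorem theorem3p2 {N : Type*} [Fintype N] [Nonempty N] [DecidableEq N] (n : N → ℕ)
    (K : ∀ ν, Set (EuclideanSpace ℝ (Fin (n ν))))
    (X : ∀ ν, jointSet K → Set (EuclideanSpace ℝ (Fin (n ν))))
    (θ : N → JointSpace n → ℝ)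
    (hK_convex : ∀ ν, Convex ℝ (K ν))
    (hK_closed : ∀ ν, IsClosed (K ν))
    (hK_nonempty : ∀ ν, (K ν).Nonempty)
    (hX_continuous : ∀ ν, SetValuedContinuous (X ν))
    (hX_convex : ∀ ν x, Convex ℝ (X ν x))
    (hX_compact : ∀ ν x, IsCompact (X ν x))
    (hX_nonempty : ∀ ν x, (X ν x).Nonempty)
    (hX_bounded : ∀ ν, Bornology.IsBounded (⋃ x, X ν x))
    (hθ_continuous : ∀ ν, PseudoContinuous (θ ν))
    (hθ_quasiconvex : ∀ ν (x : JointSpace n),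
      QuasiconvexOn ℝ Set.univ (fun z => θ ν (deviate x ν z))) :
    ∃ x : jointSet K, IsProjectedSolution K X θ x := by
  have hne : (jointSet K).Nonempty :=
    ⟨WithLp.toLp 2 fun ν => (hK_nonempty ν).some, fun ν => (hK_nonempty ν).some_mem⟩
  have hcl : IsClosed (jointSet K) := by
    have : jointSet K = ⋂ ν, (fun x : JointSpace n => x ν) ⁻¹' K ν := by
      ext x; simp [jointSet]
    rw [this]
    exact isClosed_iInter fun ν => (hK_closed ν).preimage (PiLp.continuous_apply 2 _ ν)
  have hconv : Convex ℝ (jointSet K) := fun x hx y hy s t hs ht hst ν =>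
    hK_convex ν (hx ν) (hy ν) hs ht hst
  obtain ⟨P, hPc, hP⟩ := exists_continuous_metricProj hne hcl hconv
  -- Composing with the projection defines the constraint maps on all of ℝⁿ, so their values need
  -- not return to `K` for the fixed point argument to run.
  let p : JointSpace n → jointSet K := fun y => ⟨P y, (hP y).1⟩
  have hp : Continuous p := hPc.subtype_mk _
  let T : ∀ ν, JointSpace n → Set (EuclideanSpace ℝ (Fin (n ν))) := fun ν y => X ν (p y)
  obtain ⟨R, hR⟩ := exists_closedBall_of_isBounded_coordinates hX_bounded
  obtain ⟨y, hy⟩ := exists_mem_self_of_isClosed_graph (B := bestReplies θ T) (R := R)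
    (fun y => bestReplies_nonempty hθ_continuous (fun ν => hX_compact ν _)
      fun ν => hX_nonempty ν _)
    (fun y => convex_bestReplies hθ_quasiconvex fun ν => hX_convex ν _)
    (fun y z hz => hR fun ν => Set.mem_iUnion.2 ⟨p y, (hz ν).1⟩)
    (isClosed_graph_bestReplies hθ_continuous (fun ν => (hX_continuous ν).comp hp)
      fun ν y => (hX_compact ν _).isClosed)
  refine ⟨p y, y, fun ν => (hy ν).1, hP y, fun ν => (hy ν).1, fun ν z hz => ?_⟩
  -- At a fixed point the reply of player `ν` is `y ν` itself, so replacing that block leaves `y`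
  -- unchanged and optimality becomes the Nash inequality.
  have h := (hy ν).2 z hz
  rwa [deviate_self] at h
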